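/- For an integer $c\ge 2$ let $C_c$ be the cycle graph on the vertices $1,\dots,c$, with edges $(1,2),\dots,(c-1,c),(c,1)$ (for $c=2$ this is, as far as proper colorings are concerned, a single edge). For $a,b\ge 2$ let $C_a+C_b$ be the graph on $a+b-1$ vertices obtained from $C_a$ and $C_b$ by identifying the vertex $a$ of $C_a$ with the vertex $1$ of $C_b$. The chromatic symmetric function of a finite graph $G$ is the formal power series $$X_G(\boldsymbol x)=\sum_{\kappa}\ \prod_{v\in V(G)}x_{\kappa(v)}$$ in the variables $x_i$, $i\in\mathbb N$, where $\kappa$ runs over all proper colorings $\kappa:V(G)\to\mathbb N$ of $G$. Write $e_k=\sum_{i_1<\cdots<i_k}x_{i_1}\cdots x_{i_k}$ (so $e_0=1$) and $e_\lambda=\prod_i e_{\lambda_i}$ for a partition $\lambda$. A composition $\alpha\models n$ is a tuple $(\alpha_1,\dots,\alpha_l)$ of positive integers with sum $n$, and $\mathrm{len}(\alpha)=l$. Then for all integers $a,b\ge 2$ $$X_{C_a+C_b}(\boldsymbol x)=\sum_{\substack{\alpha\models a,\ \beta\models b+\alpha_1\\ \mathrm{len}(\beta)\ge 2,\ \beta_1\le\alpha_1\le\beta_2}}\Big(\prod_{j=1}^{\mathrm{len}(\alpha)}(\alpha_j-1)\Big)(\beta_2-\beta_1+1)(\beta_1+\beta_2-\alpha_1-1)\Big(\prod_{j=3}^{\mathrm{len}(\beta)}(\beta_j-1)\Big)\,e_{\lambda(\alpha,\beta)},$$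 where $\lambda(\alpha,\beta)$ is the partition obtained by sorting $(\alpha_2,\dots,\alpha_{\mathrm{len}(\alpha)},\beta_2,\dots,\beta_{\mathrm{len}(\beta)},\beta_1-1)$ in weakly decreasing order and dropping the last part if it is $0$. Moreover, the integer coefficient of $e_{\lambda(\alpha,\beta)}$ is nonnegative for every pair $(\alpha,\beta)$ in the sum, so the formula exhibits $C_a+C_b$ as $e$-positive. -/

import Mathlib

/-- The formal power series `∑ i, x ^ (f i)` in the variables `x₀, x₁, x₂, …` for a family `f` of
exponents with finite fibres: the coefficient of `x ^ d` is the number of `i` with `f i = d`. -/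
noncomputable def sumOfMonomials {ι : Type*} (f : ι → (ℕ →₀ ℕ)) : MvPowerSeries ℕ ℤ :=
  fun d => (Nat.card {i : ι // f i = d} : ℤ)

/-- The exponent of the monomial `∏ v, x_{κ v}` of a coloring `κ`. -/
noncomputable def coloringExponent {V : Type*} [Fintype V] {G : SimpleGraph V}
    (κ : G.Coloring ℕ) : ℕ →₀ ℕ :=
  ∑ v, Finsupp.single (κ v) 1

/-- The chromatic symmetric function `X_G = ∑ ∏ v, x_{κ v}`, the sum over all proper colorings
`κ : V → ℕ` of `G`. -/
noncomputable def chromaticSymm {V : Type*} [Fintype V] (G : SimpleGraph V) :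
    MvPowerSeries ℕ ℤ :=
  sumOfMonomials (fun κ : G.Coloring ℕ => coloringExponent κ)

/-- The exponent of the monomial `∏ i ∈ s, x_i`. -/
noncomputable def subsetExponent (s : Finset ℕ) : ℕ →₀ ℕ :=
  ∑ i ∈ s, Finsupp.single i 1

/-- The elementary symmetric function `e_k = ∑ x_{i₁} ⋯ x_{i_k}` over `i₁ < ⋯ < i_k`, in infinitely
many variables: the sum runs over the `k`-element subsets of `ℕ`. -/
noncomputable def elemSymm (k : ℕ) : MvPowerSeries ℕ ℤ :=
  sumOfMonomials (fun s : {s : Finset ℕ // s.card = k} => subsetExponent s.1)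

/-- The elementary symmetric function `e_λ = ∏ e_{λ_i}` of a partition `λ`. -/
noncomputable def elemSymmPart {n : ℕ} (lam : n.Partition) : MvPowerSeries ℕ ℤ :=
  (lam.parts.map elemSymm).prod

/-- A family of exponents with finite fibres is summable, with the sum defined above. -/
theorem hasSum_sumOfMonomials {ι : Type*} (f : ι → (ℕ →₀ ℕ))
    (hf : ∀ d, Finite {i : ι // f i = d}) :
    let _ : TopologicalSpace ℤ := ⊥
    let _ : TopologicalSpace (MvPowerSeries ℕ ℤ) :=
      MvPowerSeries.WithPiTopology.instTopologicalSpace ℤ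
    HasSum (fun i => MvPowerSeries.monomial (f i) (1 : ℤ)) (sumOfMonomials f) := by
  classical
  let _ : TopologicalSpace ℤ := ⊥
  let _ : TopologicalSpace (MvPowerSeries ℕ ℤ) :=
    MvPowerSeries.WithPiTopology.instTopologicalSpace ℤ
  refine Pi.hasSum.2 fun d => ?_
  have hfin : {i : ι | f i = d}.Finite := hf d
  have hval : ∀ i, (MvPowerSeries.monomial (f i) (1 : ℤ)) d = if d = f i then 1 else 0 :=
    fun i => MvPowerSeries.coeff_monomial d (f i) 1
  simp only [hval]
  have key : (sumOfMonomials f d : ℤ) = ∑ i ∈ hfin.toFinset, if d = f i then (1 : ℤ) else 0 := by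
    rw [Finset.sum_congr rfl (g := fun _ => (1 : ℤ)) fun i hi => if_pos (by simpa using (by
      simpa using hi : f i = d).symm)]
    rw [Finset.sum_const, nsmul_eq_mul, mul_one, ← Set.ncard_eq_toFinset_card _ hfin]
    rfl
  rw [key]
  refine hasSum_sum_of_ne_finset_zero fun i hi => ?_
  have hi' : ¬ f i = d := by simpa using hi
  exact if_neg fun h => hi' h.symm

/-- Only finitely many proper colorings have a given monomial. -/
theorem finite_coloringExponent {V : Type*} [Fintype V] (G : SimpleGraph V) (d : ℕ →₀ ℕ) :
    Finite {κ : G.Coloring ℕ // coloringExponent κ = d} := by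
  classical
  have h : ∀ κ : {κ : G.Coloring ℕ // coloringExponent κ = d}, ∀ v, κ.1 v ∈ d.support := by
    rintro ⟨κ, rfl⟩ v
    rw [Finsupp.mem_support_iff]
    unfold coloringExponent
    rw [Finsupp.finsetSum_apply]
    have := Finset.single_le_sum (f := fun w => (Finsupp.single (κ w) 1 : ℕ →₀ ℕ) (κ v))
      (fun _ _ => Nat.zero_le _) (Finset.mem_univ v)
    simp only [Finsupp.single_eq_same] at this
    exact Nat.one_le_iff_ne_zero.1 this
  refine Finite.of_injective (β := V → d.support) (fun κ v => ⟨κ.1 v, h κ v⟩) ?_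
  intro κ κ' hk
  apply Subtype.ext
  ext v
  exact congrArg Subtype.val (congrFun hk v)

/-- Only finitely many `k`-element subsets have a given monomial. -/
theorem finite_subsetExponent (k : ℕ) (d : ℕ →₀ ℕ) :
    Finite {s : {s : Finset ℕ // s.card = k} // subsetExponent s.1 = d} := by
  classical
  have h : ∀ s : {s : {s : Finset ℕ // s.card = k} // subsetExponent s.1 = d},
      s.1.1 ∈ d.support.powerset := by
    rintro ⟨⟨s, hs⟩, rfl⟩
    rw [Finset.mem_powerset]
    intro i hi
    rw [Finsupp.mem_support_iff]
    simp [subsetExponent, Finsupp.finsetSum_apply, Finsupp.single_apply, hi]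
  refine Finite.of_injective (β := d.support.powerset) (fun s => ⟨s.1.1, h s⟩) ?_
  intro s t hst
  exact Subtype.ext (Subtype.ext (by simpa using hst))

/-- The graph `G₁ + G₂` on `k₁ + k₂ - 1` vertices, which identifies the last vertex of `G₁` with the
first vertex of `G₂`. The vertices are numbered from `0`: vertex `i` of `G₁` stays `i`, and vertex
`j` of `G₂` becomes `j + (k₁ - 1)`. -/
def graphChain {k₁ k₂ : ℕ} (G₁ : SimpleGraph (Fin k₁)) (G₂ : SimpleGraph (Fin k₂)) :
    SimpleGraph (Fin (k₁ + k₂ - 1)) where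
  Adj u v :=
    (∃ i j : Fin k₁, G₁.Adj i j ∧ u.val = i.val ∧ v.val = j.val) ∨
    (∃ i j : Fin k₂, G₂.Adj i j ∧ u.val = i.val + (k₁ - 1) ∧ v.val = j.val + (k₁ - 1))
  symm := ⟨by
    rintro u v (⟨i, j, h, hu, hv⟩ | ⟨i, j, h, hu, hv⟩)
    · exact Or.inl ⟨j, i, h.symm, hv, hu⟩
    · exact Or.inr ⟨j, i, h.symm, hv, hu⟩⟩
  loopless := ⟨by
    rintro u (⟨i, j, h, hu, hv⟩ | ⟨i, j, h, hu, hv⟩)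
    · exact h.ne (Fin.ext (by omega))
    · exact h.ne (Fin.ext (by omega))⟩

/-- The first part `α₁` of a composition (`0` if there is none). -/
def firstPart {n : ℕ} (α : Composition n) : ℕ := α.blocks.getD 0 0

/-- The second part `α₂` of a composition (`0` if there is none). -/
def secondPart {n : ℕ} (α : Composition n) : ℕ := α.blocks.getD 1 0

/-- The pairs of compositions `α ⊨ a`, `β ⊨ b + α₁` with `len β ≥ 2`, `β₁ ≤ α₁` and `β₂ ≥ α₁`. -/
def cyclePairs (a b : ℕ) : Finset (Σ α : Composition a, Composition (b + firstPart α)) :=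
  Finset.univ.filter fun p =>
    2 ≤ p.2.length ∧ firstPart p.2 ≤ firstPart p.1 ∧ firstPart p.1 ≤ secondPart p.2

/-- The integer `(α₁ - 1) ⋯ (α_l - 1) (β₂ - β₁ + 1) (β₁ + β₂ - α₁ - 1) (β₃ - 1) ⋯ (β_l - 1)`. -/
def cyclePairCoeff {m n : ℕ} (α : Composition m) (β : Composition n) : ℤ :=
  (α.blocks.map fun c => (c : ℤ) - 1).prod *
    ((secondPart β : ℤ) - firstPart β + 1) *
    ((firstPart β : ℤ) + secondPart β - firstPart α - 1) *
    ((β.blocks.drop 2).map fun c => (c : ℤ) - 1).prod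

/-- The list of parts of `(α ∖ α₁) · (β ∖ β₁) · (β₁ - 1)`; its last entry may be `0`. -/
def cyclePairList {m n : ℕ} (α : Composition m) (β : Composition n) : List ℕ :=
  α.blocks.tail ++ β.blocks.tail ++ [firstPart β - 1]

/-- The partition `sort ((α ∖ α₁) · (β ∖ β₁) · (β₁ - 1))`; a part equal to `0` is dropped. -/
def cyclePairType {m n : ℕ} (α : Composition m) (β : Composition n) :
    (cyclePairList α β : Multiset ℕ).sum.Partition :=
  Nat.Partition.ofMultiset (cyclePairList α β : Multiset ℕ)

/-! Fix the color c of the shared vertex. The rest of a proper coloring is a pair of independent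
closed walks based at c, one around each cycle, so X is the sum over c of x_c times two walk
weights. In finitely many variables put E(z) = ∏ (1 + x_i z), and let E_c omit the factor of c. A
transfer argument gives (E - zE') W_c = z E_c' for the generating function W_c of closed walks at c
(`elemDenom_mul_walkSeries`). As E - zE' = 1 - ∑ (k-1) e_k z^k, its inverse is the sum over
compositions of ∏ (γ_j - 1) e_{γ_j}. So a walk weight is a combination of the e_{j+1}(x∖x_c) with
symmetric coefficients (`walkWeight_self_succ`). The remaining sum over c involves x_c
e_{k+1}(x∖x_c) e_{l+1}(x∖x_c), which `sum_mul_coeff_mul_coeff_min` rewrites as a combination of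
products e_i e_{k+l+3-i}. The substitution α₁ = k+2, β₁ = i+1, β₂ = k+l+3-i then yields the stated
sum (`compositionSum_pairTerm`). Infinitely many variables are handled by comparing both sides
modulo `truncIdeal S` for every finite S. -/

/-! ### Elementary symmetric generating functions and closed walks -/

section ElementarySeries

open PowerSeries

variable {R σ : Type*} [CommRing R] [Fintype σ]

/-- The generating function `∏ i, (1 + x i * z)` of the elementary symmetric functions. -/
noncomputable def elemSeries (x : σ → R) : R⟦X⟧ := ∏ i, (1 + C (x i) * X)

theorem coeff_elemSeries (x : σ → R) (k : ℕ) :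
    coeff k (elemSeries x) = ∑ t ∈ Finset.powersetCard k Finset.univ, ∏ i ∈ t, x i := by
  rw [elemSeries, Finset.prod_one_add, map_sum]
  simp only [Finset.prod_mul_distrib, Finset.prod_const, ← map_prod, coeff_C_mul, coeff_X_pow]
  simp only [mul_ite, mul_one, mul_zero]
  rw [← Finset.sum_filter, Finset.powersetCard_eq_filter]
  simp only [eq_comm]

theorem coeff_zero_elemSeries (x : σ → R) : coeff 0 (elemSeries x) = 1 := by
  simp [elemSeries]

/-- The series `E(z) - z E'(z)`. -/
noncomputable def elemDenom (x : σ → R) : R⟦X⟧ := elemSeries x - X * d⁄dX R (elemSeries x)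

theorem coeff_elemDenom (x : σ → R) (k : ℕ) :
    coeff k (elemDenom x) = (1 - k) * coeff k (elemSeries x) := by
  rw [elemDenom, map_sub]
  cases k with
  | zero => simp
  | succ k =>
    rw [coeff_succ_X_mul, coeff_derivative]
    push_cast
    ring

theorem isUnit_one_add_C_mul_X (r : R) : IsUnit (1 + C r * X : R⟦X⟧) := by
  rw [isUnit_iff_constantCoeff]
  simp

variable [DecidableEq σ]

/-- The generating function of the elementary symmetric functions in the variables `≠ c`. -/
noncomputable def elemSeriesErase (x : σ → R) (c : σ) : R⟦X⟧ :=
  ∏ i ∈ Finset.univ.erase c, (1 + C (x i) * X)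

theorem elemSeries_eq_mul (x : σ → R) (c : σ) :
    elemSeries x = (1 + C (x c) * X) * elemSeriesErase x c :=
  (Finset.mul_prod_erase Finset.univ (fun i => 1 + C (x i) * X) (Finset.mem_univ c)).symm

theorem coeff_succ_elemSeries (x : σ → R) (c : σ) (k : ℕ) :
    coeff (k + 1) (elemSeries x) =
      coeff (k + 1) (elemSeriesErase x c) + x c * coeff k (elemSeriesErase x c) := by
  rw [elemSeries_eq_mul x c, add_mul, one_mul, map_add, mul_assoc, coeff_C_mul,
    coeff_succ_X_mul]

theorem derivative_elemSeries (x : σ → R) :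
    d⁄dX R (elemSeries x) = ∑ c, C (x c) * elemSeriesErase x c := by
  have key : ∀ s : Finset σ, d⁄dX R (∏ i ∈ s, (1 + C (x i) * X)) =
      ∑ c ∈ s, C (x c) * ∏ i ∈ s.erase c, (1 + C (x i) * X) := by
    intro s
    induction s using Finset.induction_on with
    | empty => simp
    | insert a s ha ih =>
      rw [Finset.prod_insert ha, Finset.sum_insert ha, Finset.erase_insert ha, Derivation.leibniz,
        ih]
      have : ∀ c ∈ s, C (x c) * ∏ i ∈ (insert a s).erase c, (1 + C (x i) * X) =
          (1 + C (x a) * X) * (C (x c) * ∏ i ∈ s.erase c, (1 + C (x i) * X)) := by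
        intro c hc
        have hac : a ≠ c := fun h => ha (h ▸ hc)
        rw [Finset.erase_insert_of_ne hac, Finset.prod_insert (by simp [ha])]
        ring
      rw [Finset.sum_congr rfl this, ← Finset.mul_sum]
      simp [Derivation.leibniz, derivative_C]
      ring
  exact key Finset.univ

theorem derivative_elemSeries_eq (x : σ → R) (c : σ) :
    d⁄dX R (elemSeries x) = C (x c) * elemSeriesErase x c +
      (1 + C (x c) * X) * d⁄dX R (elemSeriesErase x c) := by
  rw [elemSeries_eq_mul x c, Derivation.leibniz]
  simp [Derivation.leibniz, derivative_C]
  ring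

/-- Each monomial of e_{k+1} arises once for each of its k+1 variables; formally, this is a
coefficient of E' = ∑ x_c E_c. -/
theorem sum_mul_coeff_elemSeriesErase (x : σ → R) (k : ℕ) :
    ∑ c, x c * coeff k (elemSeriesErase x c) = (k + 1) * coeff (k + 1) (elemSeries x) := by
  have h := congrArg (coeff k) (derivative_elemSeries x)
  rw [coeff_derivative, map_sum] at h
  simp only [coeff_C_mul] at h
  rw [← h, mul_comm]

/-- `∑ c, x_c e_k(x ∖ x_c) e_l(x ∖ x_c)` as a combination of products of two elementary symmetric
functions. -/
theorem sum_mul_coeff_mul_coeff (x : σ → R) (k l : ℕ) :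
    ∑ c, x c * (coeff k (elemSeriesErase x c) * coeff l (elemSeriesErase x c)) =
      ∑ i ∈ Finset.range (k + 1), ((k : R) + l + 1 - 2 * i) *
        (coeff i (elemSeries x) * coeff (k + l + 1 - i) (elemSeries x)) := by
  induction k generalizing l with
  | zero =>
    have h0 : ∀ c, coeff 0 (elemSeriesErase x c) = 1 := fun c => by simp [elemSeriesErase]
    simp only [h0, one_mul, sum_mul_coeff_elemSeriesErase]
    simp [coeff_zero_elemSeries]
  | succ k ih =>
    -- Trade k+1, l for k, l+1: after expanding e_{k+1} and e_{l+1} by `coeff_succ_elemSeries`, the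
    -- two terms x_c e_k(x∖x_c) e_l(x∖x_c) cancel.
    have step : ∑ c, x c * (coeff (k + 1) (elemSeriesErase x c) * coeff l (elemSeriesErase x c)) =
        ∑ c, x c * (coeff k (elemSeriesErase x c) * coeff (l + 1) (elemSeriesErase x c)) +
        (coeff (k + 1) (elemSeries x) * ∑ c, x c * coeff l (elemSeriesErase x c) -
          coeff (l + 1) (elemSeries x) * ∑ c, x c * coeff k (elemSeriesErase x c)) := by
      rw [Finset.mul_sum, Finset.mul_sum, ← Finset.sum_sub_distrib, ← Finset.sum_add_distrib]
      refine Finset.sum_congr rfl fun c _ => ?_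
      rw [coeff_succ_elemSeries x c k, coeff_succ_elemSeries x c l]
      ring
    rw [step, ih, Finset.sum_range_succ _ (k + 1), sum_mul_coeff_elemSeriesErase,
      sum_mul_coeff_elemSeriesErase]
    congr 1
    · refine Finset.sum_congr rfl fun i _ => ?_
      rw [show k + (l + 1) + 1 - i = k + 1 + l + 1 - i by omega]
      push_cast
      ring
    · rw [show k + 1 + l + 1 - (k + 1) = l + 1 by omega]
      push_cast
      ring

/-- The left side is symmetric in k and l, so the shorter range may be used. The bound by both k and
l becomes the two inequalities β₁ ≤ α₁ ≤ β₂. -/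
theorem sum_mul_coeff_mul_coeff_min (x : σ → R) (k l : ℕ) :
    ∑ c, x c * (coeff k (elemSeriesErase x c) * coeff l (elemSeriesErase x c)) =
      ∑ i ∈ Finset.range (min k l + 1), ((k : R) + l + 1 - 2 * i) *
        (coeff i (elemSeries x) * coeff (k + l + 1 - i) (elemSeries x)) := by
  rcases le_total k l with h | h
  · rw [min_eq_left h, sum_mul_coeff_mul_coeff]
  · rw [min_eq_right h]
    simp only [mul_comm (coeff k (elemSeriesErase x _)), sum_mul_coeff_mul_coeff, add_comm k l,
      add_comm (k : R) l]

/-- The word `u` extended to a closed walk `d, u, c` has no two equal consecutive letters. -/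
def NoRepeat {τ : Type*} {n : ℕ} (d c : τ) (u : Fin n → τ) : Prop :=
  ∀ i : Fin (n + 1), (Fin.cons d u : Fin (n + 1) → τ) i ≠ (Fin.snoc u c : Fin (n + 1) → τ) i

instance {n : ℕ} (d c : σ) : DecidablePred (NoRepeat (n := n) d c) := fun _ =>
  inferInstanceAs (Decidable (∀ _, _))

theorem noRepeat_cons {τ : Type*} {n : ℕ} (d c d' : τ) (u : Fin n → τ) :
    NoRepeat d c (Fin.cons d' u : Fin (n + 1) → τ) ↔ d ≠ d' ∧ NoRepeat d' c u := by
  unfold NoRepeat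
  rw [Fin.forall_fin_succ, ← Fin.cons_snoc_eq_snoc_cons]
  simp

/-- The total weight of the inner words of length `n` of walks from `d` to `c`. -/
def walkWeight (x : σ → R) (c : σ) (n : ℕ) (d : σ) : R :=
  ∑ u : Fin n → σ, if NoRepeat d c u then ∏ i, x (u i) else 0

theorem walkWeight_zero (x : σ → R) (c d : σ) :
    walkWeight x c 0 d = 1 - if d = c then 1 else 0 := by
  unfold walkWeight NoRepeat
  by_cases h : d = c <;> simp [h, Fin.snoc]

/-- The first inner letter may be anything but d, and the rest is a walk starting from it. -/
theorem walkWeight_succ (x : σ → R) (c : σ) (n : ℕ) (d : σ) :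
    walkWeight x c (n + 1) d = ∑ d', x d' * walkWeight x c n d' - x d * walkWeight x c n d := by
  have h1 : walkWeight x c (n + 1) d = ∑ d', if d ≠ d' then x d' * walkWeight x c n d' else 0 := by
    unfold walkWeight
    rw [← (Fin.consEquiv (fun _ : Fin (n + 1) => σ)).sum_comp, Fintype.sum_prod_type]
    refine Finset.sum_congr rfl fun d' _ => ?_
    simp only [Fin.consEquiv, Equiv.coe_fn_mk, noRepeat_cons, Fin.prod_univ_succ, Fin.cons_zero,
      Fin.cons_succ, Finset.mul_sum]
    by_cases h : d = d' <;> simp [h]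
  rw [h1, ← Finset.sum_erase_eq_sub (Finset.mem_univ d), ← Finset.sum_filter]
  refine Finset.sum_congr ?_ fun _ _ => rfl
  ext
  simp [eq_comm]

theorem elemDenom_mul_walkSeries (x : σ → R) (c : σ) :
    elemDenom x * PowerSeries.mk (fun n => walkWeight x c n c) =
      X * d⁄dX R (elemSeriesErase x c) := by
  set M : σ → R⟦X⟧ := fun d => PowerSeries.mk fun n => walkWeight x c n d
  set Q : R⟦X⟧ := ∑ d, C (x d) * M d with hQ
  have hM : ∀ d, (1 + C (x d) * X) * M d = 1 - (if d = c then 1 else 0) + X * Q := by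
    intro d
    suffices M d = 1 - (if d = c then 1 else 0) + X * (Q - C (x d) * M d) by
      linear_combination this
    ext n
    cases n with
    | zero =>
      by_cases h : d = c <;> simp [M, walkWeight_zero, h]
    | succ n =>
      have : coeff (n + 1) (1 - (if d = c then 1 else 0) : R⟦X⟧) = 0 := by
        split_ifs <;> simp [coeff_one]
      rw [map_add, this, zero_add, coeff_succ_X_mul]
      simp [M, hQ, walkWeight_succ]
  -- Multiply `hM d` by x_d E_d and sum over d, using E' = ∑ x_d E_d.
  have hE : elemSeries x * Q = d⁄dX R (elemSeries x) - C (x c) * elemSeriesErase x c +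
      X * Q * d⁄dX R (elemSeries x) := by
    have : ∀ d, elemSeries x * (C (x d) * M d) = C (x d) * elemSeriesErase x d -
        (if d = c then C (x d) * elemSeriesErase x d else 0) +
          X * Q * (C (x d) * elemSeriesErase x d) := by
      intro d
      rw [elemSeries_eq_mul x d]
      have := hM d
      split_ifs at this ⊢ with h <;>
      linear_combination (C (x d) * elemSeriesErase x d) * this
    rw [hQ, Finset.mul_sum, Finset.sum_congr rfl fun d _ => this d, Finset.sum_add_distrib,
      Finset.sum_sub_distrib, ← Finset.mul_sum, ← derivative_elemSeries, Finset.sum_ite_eq',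
      if_pos (Finset.mem_univ c)]
  have hc := hM c
  rw [if_pos rfl] at hc
  -- By `hE`, (E - zE') Q = E' - x_c E_c = (1 + x_c z) E_c', while (1 + x_c z) M_c = zQ; the unit 1
  -- + x_c z cancels.
  refine (isUnit_one_add_C_mul_X (x c)).mul_left_cancel ?_
  change (1 + C (x c) * X) * (elemDenom x * M c) = _
  have hd := derivative_elemSeries_eq x c
  unfold elemDenom
  linear_combination (elemSeries x - X * d⁄dX R (elemSeries x)) * hc + X * hE + X * hd

end ElementarySeries

/-! ### Sums over compositions and the change of indices -/

section CompositionSum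

/-- The sum of `F` over the lists of parts of the compositions of `n`. -/
def compositionSum {M : Type*} [AddCommMonoid M] (n : ℕ) (F : List ℕ → M) : M :=
  ∑ c : Composition n, F c.blocks

variable {M : Type*} [AddCommMonoid M]

theorem compositionSum_zero (F : List ℕ → M) : compositionSum 0 F = F [] := by
  have h : ∀ c : Composition 0, c.blocks = [] := fun c => c.blocks_eq_nil.2 rfl
  simp [compositionSum, h, composition_card]

theorem compositionSum_of_pos {n : ℕ} (hn : 0 < n) (F : List ℕ → M) :
    compositionSum n F =
      ∑ j ∈ Finset.range n, compositionSum (n - 1 - j) fun l => F ((j + 1) :: l) := by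
  unfold compositionSum
  rw [Finset.sum_sigma']
  symm
  refine Finset.sum_bij (fun p hp => (⟨(p.1 + 1) :: p.2.blocks, ?_, ?_⟩ : Composition n))
    ?_ ?_ ?_ ?_
  · intro i hi
    rcases List.mem_cons.1 hi with rfl | hi
    · omega
    · exact p.2.blocks_pos hi
  · have := Finset.mem_range.1 (Finset.mem_sigma.1 hp).1
    rw [List.sum_cons, p.2.blocks_sum]
    omega
  · intros
    exact Finset.mem_univ _
  · rintro ⟨i, c⟩ _ ⟨j, d⟩ _ h
    simp only [Composition.mk.injEq, List.cons.injEq, add_left_inj] at h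
    obtain ⟨rfl, h⟩ := h
    rw [Composition.ext h]
  · intro c _
    obtain ⟨i, l, hl⟩ : ∃ i l, c.blocks = i :: l :=
      List.exists_cons_of_ne_nil fun h => hn.ne' (c.blocks_eq_nil.1 h)
    have hsum := c.blocks_sum
    have hi : 0 < i := c.blocks_pos (by simp [hl])
    rw [hl, List.sum_cons] at hsum
    refine ⟨⟨i - 1, ⟨l, fun {k} hk => c.blocks_pos (by simp [hl, hk]), by omega⟩⟩,
      by simp; omega, ?_⟩
    ext1
    simp [hl, Nat.sub_add_cancel hi]
  · intros
    rfl

theorem compositionSum_eq_sum_range {n : ℕ} (F : List ℕ → M) (h : F [] = 0) :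
    compositionSum n F =
      ∑ j ∈ Finset.range n, compositionSum (n - 1 - j) fun l => F ((j + 1) :: l) := by
  rcases Nat.eq_zero_or_pos n with rfl | hn
  · simpa [compositionSum_zero] using h
  · exact compositionSum_of_pos hn F

theorem mul_compositionSum {R : Type*} [CommRing R] (r : R) (n : ℕ) (F : List ℕ → R) :
    r * compositionSum n F = compositionSum n fun l => r * F l :=
  Finset.mul_sum _ _ _

open PowerSeries

variable {R σ : Type*} [CommRing R] [Fintype σ]

/-- The product `∏ (γ_j - 1) e_{γ_j}` over a list `γ`. -/
noncomputable def elemWeight (x : σ → R) (l : List ℕ) : R :=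
  (l.map fun k : ℕ => ((k : R) - 1) * coeff k (elemSeries x)).prod

theorem elemWeight_cons (x : σ → R) (k : ℕ) (l : List ℕ) :
    elemWeight x (k :: l) = ((k : R) - 1) * coeff k (elemSeries x) * elemWeight x l := by
  simp [elemWeight]

/-- A geometric series: splitting off the first part of a composition gives the recursion that
inverts 1 - ∑ (k-1) e_k z^k. -/
theorem elemDenom_mul_compositionSeries (x : σ → R) :
    elemDenom x * PowerSeries.mk (fun n => compositionSum n (elemWeight x)) = 1 := by
  ext n
  rw [coeff_mul]
  cases n with
  | zero => simp [compositionSum_zero, elemWeight, elemDenom, elemSeries]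
  | succ n =>
    rw [Finset.Nat.sum_antidiagonal_succ]
    simp only [coeff_elemDenom, coeff_mk, coeff_zero_elemSeries]
    rw [compositionSum_of_pos n.succ_pos, Finset.Nat.sum_antidiagonal_eq_sum_range_succ_mk]
    simp only [elemWeight_cons, ← mul_compositionSum]
    simp only [Nat.cast_zero, sub_zero, one_mul, ← Finset.sum_add_distrib]
    rw [coeff_one, if_neg n.succ_ne_zero]
    refine Finset.sum_eq_zero fun j _ => ?_
    push_cast
    ring

theorem walkWeight_self_succ [DecidableEq σ] (x : σ → R) (c : σ) (m : ℕ) :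
    walkWeight x c (m + 1) c = ∑ j ∈ Finset.range (m + 1),
      ((j : R) + 1) * coeff (j + 1) (elemSeriesErase x c) *
        compositionSum (m - j) (elemWeight x) := by
  have h : PowerSeries.mk (fun n => walkWeight x c n c) = X * (d⁄dX R (elemSeriesErase x c) *
      PowerSeries.mk (fun n => compositionSum n (elemWeight x))) := by
    linear_combination
      PowerSeries.mk (fun n => compositionSum n (elemWeight x)) * elemDenom_mul_walkSeries x c -
      PowerSeries.mk (fun n => walkWeight x c n c) * elemDenom_mul_compositionSeries x
  have := congrArg (coeff (m + 1)) h
  rw [coeff_succ_X_mul, coeff_mul, coeff_mk, Finset.Nat.sum_antidiagonal_eq_sum_range_succ_mk]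
    at this
  rw [this]
  refine Finset.sum_congr rfl fun j _ => ?_
  rw [coeff_derivative, coeff_mk]
  ring

theorem sum_walkWeight_mul_walkWeight [DecidableEq σ] (x : σ → R) (m n : ℕ) :
    ∑ c, x c * (walkWeight x c (m + 1) c * walkWeight x c (n + 1) c) =
      ∑ k ∈ Finset.range (m + 1), ∑ l ∈ Finset.range (n + 1),
        ∑ i ∈ Finset.range (min k l + 2),
          ((k : R) + 1) * (l + 1) * ((k : R) + l + 3 - 2 * i) *
            (coeff i (elemSeries x) * coeff (k + l + 3 - i) (elemSeries x)) *
            (compositionSum (m - k) (elemWeight x) * compositionSum (n - l) (elemWeight x)) := by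
  simp only [walkWeight_self_succ, Finset.sum_mul_sum]
  simp only [Finset.mul_sum]
  rw [Finset.sum_comm]
  refine Finset.sum_congr rfl fun k _ => ?_
  rw [Finset.sum_comm]
  refine Finset.sum_congr rfl fun l _ => ?_
  have h := sum_mul_coeff_mul_coeff_min x (k + 1) (l + 1)
  rw [show min (k + 1) (l + 1) + 1 = min k l + 2 by omega] at h
  calc _ = ((k : R) + 1) * (l + 1) *
        (compositionSum (m - k) (elemWeight x) * compositionSum (n - l) (elemWeight x)) *
        ∑ c, x c * (coeff (k + 1) (elemSeriesErase x c) * coeff (l + 1) (elemSeriesErase x c)) := by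
        rw [Finset.mul_sum]
        exact Finset.sum_congr rfl fun c _ => by ring
    _ = _ := by
        rw [h, Finset.mul_sum]
        refine Finset.sum_congr rfl fun i _ => ?_
        rw [show k + 1 + (l + 1) + 1 - i = k + l + 3 - i by omega]
        push_cast
        ring

/-- The summand belonging to a pair of compositions with lists of parts `A` and `B`. -/
noncomputable def pairTerm (e : ℕ → R) (A B : List ℕ) : R :=
  if 2 ≤ B.length ∧ B.getD 0 0 ≤ A.getD 0 0 ∧ A.getD 0 0 ≤ B.getD 1 0 then
    (((A.map fun c : ℕ => (c : ℤ) - 1).prod * ((B.getD 1 0 : ℤ) - B.getD 0 0 + 1) *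
      ((B.getD 0 0 : ℤ) + B.getD 1 0 - A.getD 0 0 - 1) *
      ((B.drop 2).map fun c : ℕ => (c : ℤ) - 1).prod : ℤ) : R) *
      ((A.tail ++ B.tail ++ [B.getD 0 0 - 1]).map e).prod
  else 0

theorem pairTerm_cons_cons_cons (x : σ → R) (p u v : ℕ) (A B : List ℕ) :
    pairTerm (fun k => coeff k (elemSeries x)) (p :: A) ((u + 1) :: (v + 1) :: B) =
      if u + 1 ≤ p ∧ p ≤ v + 1 then
        ((p : R) - 1) * ((v : R) - u + 1) * ((u : R) + v + 1 - p) *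
          (coeff u (elemSeries x) * coeff (v + 1) (elemSeries x)) *
          (elemWeight x A * elemWeight x B)
      else 0 := by
  unfold pairTerm elemWeight
  simp [List.prod_map_mul, Function.comp_def]
  refine if_congr Iff.rfl ?_ rfl
  ring

/-- With α₁ = k+2, β₁ = i+1 and β₂ = k+l+3-i, the factors α₁-1, β₁+β₂-α₁-1 and β₂-β₁+1 are k+1, l+1
and k+l+3-2i. The other parts of α and β form compositions of m-k and n-l. -/
theorem compositionSum_pairTerm (x : σ → R) (m n : ℕ) :
    compositionSum (m + 2) (fun A => compositionSum (n + 2 + A.getD 0 0)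
        (pairTerm (fun k => coeff k (elemSeries x)) A)) =
      ∑ k ∈ Finset.range (m + 1), ∑ l ∈ Finset.range (n + 1),
        ∑ i ∈ Finset.range (min k l + 2),
          ((k : R) + 1) * (l + 1) * ((k : R) + l + 3 - 2 * i) *
            (coeff i (elemSeries x) * coeff (k + l + 3 - i) (elemSeries x)) *
            (compositionSum (m - k) (elemWeight x) * compositionSum (n - l) (elemWeight x)) := by
  have hB : ∀ (p N : ℕ) (A : List ℕ),
      compositionSum N (pairTerm (fun k => coeff k (elemSeries x)) (p :: A)) =
      ∑ u ∈ Finset.range N, ∑ v ∈ Finset.range (N - 1 - u),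
        if u + 1 ≤ p ∧ p ≤ v + 1 then
          ((p : R) - 1) * ((v : R) - u + 1) * ((u : R) + v + 1 - p) *
          (coeff u (elemSeries x) * coeff (v + 1) (elemSeries x)) *
          (elemWeight x A * compositionSum (N - 1 - u - 1 - v) (elemWeight x))
        else 0 := by
    intro p N A
    rw [compositionSum_eq_sum_range _ (by simp [pairTerm])]
    refine Finset.sum_congr rfl fun u _ => ?_
    rw [compositionSum_eq_sum_range _ (by simp [pairTerm])]
    refine Finset.sum_congr rfl fun v _ => ?_
    simp only [pairTerm_cons_cons_cons]
    split_ifs with h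
    · simp only [← mul_compositionSum]
    · simp [compositionSum]
  rw [compositionSum_of_pos (by omega), Finset.sum_range_succ']
  simp only [List.getD_cons_zero, hB]
  -- Compositions with α₁ = 1 contribute nothing because of the factor α₁ - 1.
  have hz : compositionSum (m + 2 - 1 - 0) (fun l => ∑ u ∈ Finset.range (n + 2 + (0 + 1)),
      ∑ v ∈ Finset.range (n + 2 + (0 + 1) - 1 - u),
        if u + 1 ≤ 0 + 1 ∧ 0 + 1 ≤ v + 1 then
          (((0 + 1 : ℕ) : R) - 1) * ((v : R) - u + 1) * ((u : R) + v + 1 - (0 + 1 : ℕ)) *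
          (coeff u (elemSeries x) * coeff (v + 1) (elemSeries x)) *
          (elemWeight x l * compositionSum (n + 2 + (0 + 1) - 1 - u - 1 - v) (elemWeight x))
        else 0) = 0 := by
    simp [compositionSum]
  rw [hz, add_zero]
  refine Finset.sum_congr rfl fun k _ => ?_
  rw [show m + 2 - 1 - (k + 1) = m - k by omega]
  calc _ = ∑ u ∈ Finset.range (n + 2 + (k + 1 + 1)),
      ∑ v ∈ Finset.range (n + 2 + (k + 1 + 1) - 1 - u),
        if u + 1 ≤ k + 1 + 1 ∧ k + 1 + 1 ≤ v + 1 then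
          (((k + 1 + 1 : ℕ) : R) - 1) * ((v : R) - u + 1) * ((u : R) + v + 1 - (k + 1 + 1 : ℕ)) *
          (coeff u (elemSeries x) * coeff (v + 1) (elemSeries x)) *
          (compositionSum (m - k) (elemWeight x) *
            compositionSum (n + 2 + (k + 1 + 1) - 1 - u - 1 - v) (elemWeight x))
        else 0 := by
        rw [compositionSum, Finset.sum_comm]
        refine Finset.sum_congr rfl fun u _ => ?_
        rw [Finset.sum_comm]
        refine Finset.sum_congr rfl fun v _ => ?_
        split_ifs with h
        · rw [← Finset.mul_sum, ← Finset.sum_mul]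
          rfl
        · simp
    _ = _ := by
        rw [Finset.sum_sigma', Finset.sum_sigma']
        symm
        -- Here (l, i) goes to (u, v) = (β₁ - 1, β₂ - 1), so l = u + v - k - 2.
        refine Finset.sum_of_injOn (fun p => ⟨p.2, p.1 + k + 2 - p.2⟩) ?_ ?_ ?_ ?_
        · rintro ⟨l, i⟩ h ⟨l', i'⟩ h' heq
          simp only [Finset.coe_sigma, Set.mem_sigma_iff, Finset.mem_coe, Finset.mem_range]
            at h h'
          simp only [Sigma.mk.injEq, heq_eq_eq] at heq
          obtain ⟨rfl, heq⟩ := heq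
          obtain rfl : l = l' := by omega
          rfl
        · rintro ⟨l, i⟩ h
          simp only [Finset.coe_sigma, Set.mem_sigma_iff, Finset.mem_coe, Finset.mem_range]
            at h ⊢
          omega
        · rintro ⟨u, v⟩ h hn
          simp only [Finset.mem_sigma, Finset.mem_range] at h
          dsimp only
          split_ifs with hc
          -- The conditions force u + v ≥ k + 1. Equality would mean l = -1: such a pair is not in
          -- the image, but its factor u + v - k - 1 vanishes.
          · by_cases huv : u + v = k + 1
            · have : (u : R) + v + 1 - (k + 1 + 1 : ℕ) = 0 := by
                have := congrArg (Nat.cast (R := R)) huv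
                push_cast at this ⊢
                linear_combination this
              simp only [this, mul_zero, zero_mul]
            · refine absurd ⟨⟨u + v - (k + 2), u⟩, ?_, ?_⟩ hn
              · simp only [Finset.coe_sigma, Set.mem_sigma_iff, Finset.mem_coe, Finset.mem_range]
                omega
              · simp only [Sigma.mk.injEq, heq_eq_eq, true_and]
                omega
          · rfl
        · rintro ⟨l, i⟩ h
          simp only [Finset.mem_sigma, Finset.mem_range] at h
          dsimp only
          rw [if_pos (by omega), show l + k + 2 - i + 1 = k + l + 3 - i by omega,
            show n + 2 + (k + 1 + 1) - 1 - i - 1 - (l + k + 2 - i) = n - l by omega,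
            Nat.cast_sub (by omega)]
          push_cast
          ring

end CompositionSum

/-! ### Colorings of two cycles sharing a vertex as pairs of closed walks -/

section GraphColorings

theorem forall_graphChain_adj {τ : Type*} {k₁ k₂ : ℕ} (hk₁ : 0 < k₁) (hk₂ : 0 < k₂)
    (G₁ : SimpleGraph (Fin k₁)) (G₂ : SimpleGraph (Fin k₂)) (κ : Fin (k₁ + k₂ - 1) → τ) :
    (∀ u v, (graphChain G₁ G₂).Adj u v → κ u ≠ κ v) ↔
      (∀ i j, G₁.Adj i j → κ ⟨i, by omega⟩ ≠ κ ⟨j, by omega⟩) ∧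
      (∀ i j, G₂.Adj i j → κ ⟨i + (k₁ - 1), by omega⟩ ≠ κ ⟨j + (k₁ - 1), by omega⟩) := by
  constructor
  · intro h
    exact ⟨fun i j hij => h _ _ (Or.inl ⟨i, j, hij, rfl, rfl⟩),
      fun i j hij => h _ _ (Or.inr ⟨i, j, hij, rfl, rfl⟩)⟩
  · rintro ⟨h₁, h₂⟩ u v (⟨i, j, hij, hu, hv⟩ | ⟨i, j, hij, hu, hv⟩)
    · convert h₁ i j hij using 2 <;> exact Fin.ext (by assumption)
    · convert h₂ i j hij using 2 <;> exact Fin.ext (by assumption)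

theorem forall_cycleGraph_adj {τ : Type*} {n : ℕ} (f : Fin (n + 2) → τ) :
    (∀ i j, (SimpleGraph.cycleGraph (n + 2)).Adj i j → f i ≠ f j) ↔ ∀ i, f i ≠ f (i + 1) := by
  constructor
  · intro h i
    exact h _ _ (SimpleGraph.cycleGraph_adj.2 (Or.inr (by simp)))
  · intro h i j hij
    rcases SimpleGraph.cycleGraph_adj.1 hij with hij | hij
    · obtain rfl := sub_eq_iff_eq_add'.1 hij
      exact (h j).symm
    · obtain rfl := sub_eq_iff_eq_add'.1 hij
      exact h i

/-- A closed walk is a cyclic word and `Fin.snoc u c` is a rotation of `Fin.cons c u`. Both forms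
are needed: the shared vertex is the last of one cycle and the first of the other. -/
theorem noRepeat_iff_cons {τ : Type*} {n : ℕ} (c : τ) (u : Fin n → τ) :
    NoRepeat c c u ↔ ∀ i : Fin (n + 1),
      (Fin.cons c u : Fin (n + 1) → τ) i ≠ (Fin.cons c u : Fin (n + 1) → τ) (i + 1) := by
  simp only [NoRepeat, Fin.snoc_eq_cons_rotate, finRotate_apply]

theorem noRepeat_iff_snoc {τ : Type*} {n : ℕ} (c : τ) (u : Fin n → τ) :
    NoRepeat c c u ↔ ∀ i : Fin (n + 1),
      (Fin.snoc u c : Fin (n + 1) → τ) i ≠ (Fin.snoc u c : Fin (n + 1) → τ) (i + 1) := by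
  rw [noRepeat_iff_cons]
  simp only [Fin.snoc_eq_cons_rotate, finRotate_apply]
  exact (Equiv.addRight (1 : Fin (n + 1))).forall_congr_right.symm

variable {R σ : Type*} [CommRing R] [Fintype σ] [DecidableEq σ]

open Classical in
/-- The sum of `∏ v, x (κ v)` over the proper colorings of two cycles sharing a vertex. -/
theorem sum_colorings_cycleChain (x : σ → R) (m n : ℕ) :
    (∑ κ : Fin (m + 2 + (n + 2) - 1) → σ,
      if ∀ u v, (graphChain (SimpleGraph.cycleGraph (m + 2))
        (SimpleGraph.cycleGraph (n + 2))).Adj u v → κ u ≠ κ v then ∏ v, x (κ v) else 0) =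
      ∑ c, x c * (walkWeight x c (m + 1) c * walkWeight x c (n + 1) c) := by
  simp only [forall_graphChain_adj (Nat.succ_pos (m + 1)) (Nat.succ_pos (n + 1)),
    forall_cycleGraph_adj
      (fun i : Fin (m + 2) => (_ : Fin (m + 2 + (n + 2) - 1) → σ) ⟨i, by omega⟩),
    forall_cycleGraph_adj
      (fun i : Fin (n + 2) => (_ : Fin (m + 2 + (n + 2) - 1) → σ) ⟨i + (m + 2 - 1), by omega⟩)]
  have hR : ∀ c, x c * (walkWeight x c (m + 1) c * walkWeight x c (n + 1) c) =
      ∑ u : Fin (m + 1) → σ, ∑ v : Fin (n + 1) → σ,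
        if NoRepeat c c u ∧ NoRepeat c c v then (∏ i, x (u i)) * x c * ∏ i, x (v i) else 0 := by
    intro c
    rw [walkWeight, walkWeight, Finset.sum_mul_sum, Finset.mul_sum]
    refine Finset.sum_congr rfl fun u _ => ?_
    rw [Finset.mul_sum]
    refine Finset.sum_congr rfl fun v _ => ?_
    by_cases hu : NoRepeat c c u <;> by_cases hv : NoRepeat c c v <;> simp [hu, hv]
    ring
  -- A coloring is read as the word u, c, v, with c at the shared vertex m+1.
  let e : σ × (Fin (m + 1) → σ) × (Fin (n + 1) → σ) ≃ (Fin (m + 2 + (n + 2) - 1) → σ) :=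
    (Equiv.prodAssoc _ _ _).symm.trans
      (((Fin.snocEquiv (fun _ : Fin (m + 2) => σ)).prodCongr (Equiv.refl _)).trans
        (Fin.appendEquiv (m + 2) (n + 1)))
  have he : ∀ c u v, e (c, u, v) = Fin.append (Fin.snoc u c : Fin (m + 2) → σ) v :=
    fun _ _ _ => rfl
  have h₁ : ∀ c u v (i : Fin (m + 2)),
      e (c, u, v) ⟨i, by omega⟩ = (Fin.snoc u c : Fin (m + 2) → σ) i := by
    intro c u v i
    rw [he]
    exact Fin.append_left _ _ i
  have h₂ : ∀ c u v (i : Fin (n + 2)),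
      e (c, u, v) ⟨i + (m + 2 - 1), by omega⟩ = (Fin.cons c v : Fin (n + 2) → σ) i := by
    intro c u v i
    rw [he]
    refine Fin.cases ?_ (fun j => ?_) i
    · refine Eq.trans (congrArg _ (Fin.ext ?_))
        ((Fin.append_left (Fin.snoc u c : Fin (m + 2) → σ) v (Fin.last (m + 1))).trans ?_)
      · simp
      · simp
    · refine Eq.trans (congrArg _ (Fin.ext ?_))
        (Fin.append_right (Fin.snoc u c : Fin (m + 2) → σ) v j)
      simp
      omega
  rw [← e.sum_comp, Fintype.sum_prod_type]
  refine Finset.sum_congr rfl fun c _ => ?_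
  rw [hR, Fintype.sum_prod_type]
  refine Finset.sum_congr rfl fun u _ => Finset.sum_congr rfl fun v _ => ?_
  simp only [h₁, h₂, noRepeat_iff_snoc c u, noRepeat_iff_cons c v]
  refine if_congr Iff.rfl ?_ rfl
  rw [he]
  refine (Fin.prod_univ_add (a := m + 2) (b := n + 1)
    (fun i => x (Fin.append (Fin.snoc u c : Fin (m + 2) → σ) v i))).trans ?_
  simp [Fin.prod_univ_castSucc]

end GraphColorings

/-! ### Reduction to finitely many variables -/

section Truncation

/-- The power series without monomials in the variables from `S`. -/
def truncIdeal (S : Finset ℕ) : Ideal (MvPowerSeries ℕ ℤ) where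
  carrier := {f | ∀ d : ℕ →₀ ℕ, d.support ⊆ S → MvPowerSeries.coeff d f = 0}
  zero_mem' _ _ := map_zero _
  add_mem' hf hg d hd := by rw [map_add, hf d hd, hg d hd, add_zero]
  smul_mem' g f hf d hd := by
    classical
    rw [smul_eq_mul, MvPowerSeries.coeff_mul]
    refine Finset.sum_eq_zero fun p hp => ?_
    rw [hf p.2 ((Finsupp.support_mono ?_).trans hd), mul_zero]
    rw [← Finset.HasAntidiagonal.mem_antidiagonal.1 hp]
    exact le_add_self

/-- The restriction of power series to the variables from `S`. -/
noncomputable abbrev truncMk (S : Finset ℕ) :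
    MvPowerSeries ℕ ℤ →+* MvPowerSeries ℕ ℤ ⧸ truncIdeal S :=
  Ideal.Quotient.mk (truncIdeal S)

theorem truncMk_eq_iff {S : Finset ℕ} {f g : MvPowerSeries ℕ ℤ} :
    truncMk S f = truncMk S g ↔
      ∀ d : ℕ →₀ ℕ, d.support ⊆ S → MvPowerSeries.coeff d f = MvPowerSeries.coeff d g := by
  rw [Ideal.Quotient.eq]
  refine forall₂_congr fun d hd => ?_
  rw [map_sub, sub_eq_zero]

/-- Only indices whose monomial lies in the variables from S survive, so a finite J that covers them
injectively turns the formal sum into a finite one. -/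
theorem truncMk_sumOfMonomials {ι J : Type*} [Fintype J] (S : Finset ℕ) (f : ι → (ℕ →₀ ℕ))
    (h : J → ι) (hinj : Function.Injective h)
    (hrange : ∀ i, (f i).support ⊆ S → i ∈ Set.range h) :
    truncMk S (sumOfMonomials f) =
      ∑ j, truncMk S (MvPowerSeries.monomial (f (h j)) 1) := by
  classical
  rw [← map_sum, truncMk_eq_iff]
  intro d hd
  rw [map_sum]
  simp only [MvPowerSeries.coeff_monomial]
  rw [Finset.sum_boole]
  change (Nat.card {i : ι // f i = d} : ℤ) = _
  rw [← Fintype.card_subtype, ← Nat.card_eq_fintype_card]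
  congr 1
  refine (Nat.card_congr (Equiv.ofBijective
    (fun j : {j : J // d = f (h j)} => (⟨h j.1, j.2.symm⟩ : {i : ι // f i = d})) ⟨?_, ?_⟩)).symm
  · intro j j' hj
    exact Subtype.ext (hinj (congrArg Subtype.val hj))
  · rintro ⟨i, rfl⟩
    obtain ⟨j, rfl⟩ := hrange i hd
    exact ⟨⟨j, rfl⟩, rfl⟩

theorem monomial_sum_single {ι : Type*} (s : Finset ι) (g : ι → ℕ) :
    MvPowerSeries.monomial (∑ i ∈ s, Finsupp.single (g i) 1) (1 : ℤ) =
      ∏ i ∈ s, MvPowerSeries.X (g i) := by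
  classical
  induction s using Finset.induction_on with
  | empty => simp [MvPowerSeries.monomial_zero_one]
  | insert a s ha ih =>
    rw [Finset.sum_insert ha, Finset.prod_insert ha, ← ih, MvPowerSeries.X,
      MvPowerSeries.monomial_mul_monomial, mul_one]

/-- The variables from `S` in the truncated power series ring. -/
noncomputable def truncVar (S : Finset ℕ) (i : S) : MvPowerSeries ℕ ℤ ⧸ truncIdeal S :=
  truncMk S (MvPowerSeries.X (i : ℕ))

theorem support_subset_of_sum_single {ι : Type*} {s : Finset ι} {g : ι → ℕ} {S : Finset ℕ}
    (h : (∑ i ∈ s, Finsupp.single (g i) 1 : ℕ →₀ ℕ).support ⊆ S) {i : ι} (hi : i ∈ s) :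
    g i ∈ S := by
  classical
  refine h (Finsupp.support_mono (Finset.single_le_sum
    (f := fun i => (Finsupp.single (g i) 1 : ℕ →₀ ℕ)) (fun _ _ => zero_le) hi) ?_)
  simp

theorem truncMk_elemSymm (S : Finset ℕ) (k : ℕ) :
    truncMk S (elemSymm k) = PowerSeries.coeff k (elemSeries (truncVar S)) := by
  classical
  rw [coeff_elemSeries, elemSymm, ← Finset.sum_coe_sort,
    truncMk_sumOfMonomials S _
      (fun t : Finset.powersetCard k (Finset.univ : Finset S) =>
        (⟨t.1.map (Function.Embedding.subtype _), by
          rw [Finset.card_map]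
          exact (Finset.mem_powersetCard.1 t.2).2⟩ : {s : Finset ℕ // s.card = k}))]
  · refine Finset.sum_congr rfl fun t _ => ?_
    rw [subsetExponent, monomial_sum_single, map_prod, Finset.prod_map]
    rfl
  · intro t t' h
    exact Subtype.ext (Finset.map_injective _ (congrArg Subtype.val h))
  · rintro ⟨s, hs⟩ hsub
    have hsS : ∀ i ∈ s, i ∈ S := fun i hi => support_subset_of_sum_single (g := fun i => i) hsub hi
    have hmap : (s.subtype (· ∈ S)).map (Function.Embedding.subtype _) = s := by
      rw [Finset.subtype_map_of_mem hsS]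
    refine ⟨⟨s.subtype (· ∈ S), ?_⟩, Subtype.ext hmap⟩
    rw [Finset.mem_powersetCard]
    refine ⟨Finset.subset_univ _, ?_⟩
    rw [← hs, ← Finset.card_map (Function.Embedding.subtype (· ∈ S)), hmap]

open Classical in
theorem truncMk_chromaticSymm {V : Type*} [Fintype V] (S : Finset ℕ) (G : SimpleGraph V) :
    truncMk S (chromaticSymm G) = ∑ κ : V → S,
      if ∀ u v, G.Adj u v → κ u ≠ κ v then ∏ v, truncVar S (κ v) else 0 := by
  rw [← Finset.sum_filter, ← Finset.sum_subtype_eq_sum_filter, chromaticSymm,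
    truncMk_sumOfMonomials S _ (fun κ : {κ : V → S // ∀ u v, G.Adj u v → κ u ≠ κ v} =>
      SimpleGraph.Coloring.mk (fun v => (κ.1 v : ℕ)) fun {u v} h =>
        Subtype.coe_injective.ne (κ.2 u v h))]
  · rw [Finset.subtype_univ]
    refine Finset.sum_congr rfl fun κ _ => ?_
    rw [coloringExponent, monomial_sum_single, map_prod]
    rfl
  · intro κ κ' h
    refine Subtype.ext (funext fun v => Subtype.ext ?_)
    exact congrArg (fun c : G.Coloring ℕ => c v) h
  · intro κ hκ
    refine ⟨⟨fun v => ⟨κ v, support_subset_of_sum_single hκ (Finset.mem_univ v)⟩,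
      fun u v h heq => κ.valid h (congrArg Subtype.val heq)⟩, ?_⟩
    ext v
    rfl

end Truncation

/-! ### Assembly and nonnegativity -/

section MainTheorem

/-- Dropping zero parts is harmless because e_0 maps to 1. -/
theorem map_elemSymmPart {R : Type*} [CommRing R] (φ : MvPowerSeries ℕ ℤ →+* R)
    (h0 : φ (elemSymm 0) = 1) (l : List ℕ) :
    φ (elemSymmPart (Nat.Partition.ofMultiset (l : Multiset ℕ))) =
      (l.map fun k => φ (elemSymm k)).prod := by
  have h : (Nat.Partition.ofMultiset (l : Multiset ℕ)).parts =
      (l : Multiset ℕ).filter (· ≠ 0) := rfl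
  rw [elemSymmPart, h, map_multiset_prod]
  clear h
  induction l with
  | nil => simp
  | cons k l ih =>
    rw [← Multiset.cons_coe, List.map_cons, List.prod_cons, ← ih]
    by_cases hk : k = 0
    · subst hk
      rw [Multiset.filter_cons_of_neg (p := (· ≠ 0)) _ (by simp), h0, one_mul]
    · rw [Multiset.filter_cons_of_pos (p := (· ≠ 0)) _ hk]
      simp

/-- In `cyclePairCoeff` the cast to ℤ is elaborated as a monadic coercion of the whole list; moving
it inside the map matches `pairTerm`. -/
theorem cyclePairCoeff_eq {m n : ℕ} (α : Composition m) (β : Composition n) :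
    cyclePairCoeff α β = (α.blocks.map fun c : ℕ => (c : ℤ) - 1).prod *
      ((secondPart β : ℤ) - firstPart β + 1) *
      ((firstPart β : ℤ) + secondPart β - firstPart α - 1) *
      ((β.blocks.drop 2).map fun c : ℕ => (c : ℤ) - 1).prod := by
  have h : ∀ l : List ℕ, (l >>= fun k => pure (k : ℤ)) = l.map Nat.cast :=
    fun _ => List.map_eq_flatMap.symm
  unfold cyclePairCoeff
  rw [h, h, List.map_map, List.map_map]
  rfl

theorem sum_cyclePairs {R : Type*} [CommRing R] (φ : MvPowerSeries ℕ ℤ →+* R)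
    (h0 : φ (elemSymm 0) = 1) (a b : ℕ) :
    ∑ p ∈ cyclePairs a b, φ (cyclePairCoeff p.1 p.2 • elemSymmPart (cyclePairType p.1 p.2)) =
      compositionSum a fun A => compositionSum (b + A.getD 0 0)
        (pairTerm (fun k => φ (elemSymm k)) A) := by
  rw [cyclePairs, Finset.sum_filter, ← Finset.univ_sigma_univ, Finset.sum_sigma]
  refine Finset.sum_congr rfl fun α _ => Finset.sum_congr rfl fun β _ => ?_
  refine if_congr Iff.rfl ?_ rfl
  rw [map_zsmul, zsmul_eq_mul, cyclePairType, map_elemSymmPart φ h0, cyclePairList,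
    cyclePairCoeff_eq]
  rfl

theorem prod_map_sub_one_nonneg (l : List ℕ) (h : ∀ k ∈ l, 0 < k) :
    0 ≤ (l.map fun k : ℕ => (k : ℤ) - 1).prod := by
  refine List.prod_nonneg fun z hz => ?_
  obtain ⟨k, hk, rfl⟩ := List.mem_map.1 hz
  have := h k hk
  omega

theorem cyclePairCoeff_nonneg {a b : ℕ} {p : Σ α : Composition a, Composition (b + firstPart α)}
    (hp : p ∈ cyclePairs a b) : 0 ≤ cyclePairCoeff p.1 p.2 := by
  obtain ⟨hlen, h₁, h₂⟩ := (Finset.mem_filter.1 hp).2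
  have hpos : 0 < firstPart p.2 := by
    rw [firstPart, List.getD_eq_getElem _ _ (by rw [p.2.blocks_length]; omega)]
    exact p.2.blocks_pos' 0 _
  have hα := prod_map_sub_one_nonneg p.1.blocks fun k hk => p.1.blocks_pos hk
  have hβ := prod_map_sub_one_nonneg (p.2.blocks.drop 2) fun k hk =>
    p.2.blocks_pos (List.mem_of_mem_drop hk)
  rw [cyclePairCoeff_eq]
  -- From β₁ ≤ α₁ ≤ β₂: β₂ - β₁ + 1 ≥ 1 and β₁ + β₂ - α₁ - 1 ≥ β₁ - 1 ≥ 0.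
  exact mul_nonneg (mul_nonneg (mul_nonneg hα (by omega)) (by omega)) hβ

theorem mainTheorem5 (a b : ℕ) (ha : 2 ≤ a) (hb : 2 ≤ b) :
    chromaticSymm (graphChain (SimpleGraph.cycleGraph a) (SimpleGraph.cycleGraph b)) =
        ∑ p ∈ cyclePairs a b, cyclePairCoeff p.1 p.2 • elemSymmPart (cyclePairType p.1 p.2) ∧
      ∀ p ∈ cyclePairs a b, 0 ≤ cyclePairCoeff p.1 p.2 := by
  refine ⟨?_, fun p hp => cyclePairCoeff_nonneg hp⟩
  obtain ⟨m, rfl⟩ := Nat.exists_eq_add_of_le' ha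
  obtain ⟨n, rfl⟩ := Nat.exists_eq_add_of_le' hb
  suffices h : ∀ S : Finset ℕ, truncMk S (chromaticSymm
      (graphChain (SimpleGraph.cycleGraph (m + 2)) (SimpleGraph.cycleGraph (n + 2)))) =
      truncMk S (∑ p ∈ cyclePairs (m + 2) (n + 2),
        cyclePairCoeff p.1 p.2 • elemSymmPart (cyclePairType p.1 p.2)) by
    -- The coefficient of x^d is already visible in the variables of its support.
    ext d
    exact truncMk_eq_iff.1 (h d.support) d subset_rfl
  intro S
  have h0 : truncMk S (elemSymm 0) = 1 := by rw [truncMk_elemSymm, coeff_zero_elemSeries]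
  have hcol := sum_colorings_cycleChain (truncVar S) m n
  rw [truncMk_chromaticSymm]
  refine Eq.trans (by congr!) (hcol.trans ?_)
  rw [sum_walkWeight_mul_walkWeight, map_sum,
    sum_cyclePairs _ h0]
  simp only [truncMk_elemSymm]
  rw [compositionSum_pairTerm]

end MainTheorem
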